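/- For a group $K$ let $\mathcal F(K)$ be the set of nonempty finite subsets of $K$ and $\overline{\mathcal F}(K)$ the set of symmetric finite subsets of $K$ containing the identity. A free p.m.p. action $K\curvearrowright (Z,\mu)$ is a measure-preserving action on a standard Borel space with a Borel probability measure for which $\mu$-almost every point has trivial stabilizer. For $S\subseteq K$, an $S$-edge is a pair $(x,sx)$ with $x\in Z$, $s\in S$; the length of a path is its number of edges. A class $\mathfrak Y$ of free p.m.p. actions of $K$ has property SC if for every function $\Upsilon:\mathcal F(K)\to[0,\infty)$ there is an $S\in\overline{\mathcal F}(K)$ such that for every $T\in\overline{\mathcal F}(K)$ there are $C,n\in\mathbb N$ and $S_1,\dots,S_n\in\overline{\mathcal F}(K)$ such that for every action $K\curvearrowright(Z,\mu)$ in $\mathfrak Y$ there are Borel sets $W,\mathcal V_1,\dots,\mathcal V_n\subseteq Z$ satisfying: (i) $\sum_{j=1}^n\Upsilon(S_j)\mu(\mathcal V_j)\le 1$; (ii) $SW=Z$; (iii) if $w_1,w_2\in W$ and $gw_1=w_2$ for some $g\in T$, then $w_1$ and $w_2$ are connected by a path of length at most $C$ in which each edge is, for some $1\le j\le n$, an $S_j$-edge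 with both endpoints in $\mathcal V_j$. For groups $G$ and $\Gamma$, the group $G\times\Gamma$ has property SC for product actions if the class of all actions of the following form has property SC: the product action $G\times\Gamma\curvearrowright(X\times Y,\mu)$, $(g,\gamma)(x,y)=(gx,\gamma y)$, where $G\curvearrowright X$ and $\Gamma\curvearrowright Y$ are free Borel actions on standard Borel spaces (every point has trivial stabilizer) and $\mu$ is any $(G\times\Gamma)$-invariant Borel probability measure on $X\times Y$ (not necessarily a product measure). A group is locally finite if each of its finitely generated subgroups is finite. **Proposition.** Let $G$ and $\Gamma$ be countably infinite groups. Then $G\times\Gamma$ has property SC for product actions if and only if at least one of $G$ and $\Gamma$ is not locally finite. -/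

import Mathlib

open MeasureTheory
open scoped NNReal ENNReal Pointwise

universe u v w

/-- A group is locally finite if each of its finitely generated subgroups is finite. -/
def IsLocallyFiniteGroup (G : Type u) [Group G] : Prop :=
  ∀ H : Subgroup G, H.FG → Finite H

/-- The nonempty finite subsets of `G`. -/
abbrev FinSets (G : Type u) : Type u :=
  {F : Finset G // F.Nonempty}

/-- The symmetric finite subsets of `G` containing the identity. -/
abbrev SymmFinSets (G : Type u) [Group G] : Type u :=
  {F : Finset G // (∀ g ∈ F, g⁻¹ ∈ F) ∧ (1 : G) ∈ F}

/-- A symmetric finite subset containing the identity, seen as a nonempty finite subset. -/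
def SymmFinSets.toFinSets {G : Type u} [Group G] (S : SymmFinSets G) : FinSets G :=
  ⟨S.1, ⟨1, S.2.2⟩⟩

/-- A free probability-measure-preserving action of `G` on a standard probability space:
almost every point has trivial stabilizer. -/
structure FreePMPAction (G : Type u) [Group G] : Type (max u (w + 1)) where
  /-- The underlying standard Borel space. -/
  carrier : Type w
  [measurableSpace : MeasurableSpace carrier]
  [standardBorel : StandardBorelSpace carrier]
  [action : MulAction G carrier]
  /-- The invariant probability measure. -/
  μ : Measure carrier
  [isProbabilityMeasure : IsProbabilityMeasure μ]
  measurePreserving_smul : ∀ g : G, MeasurePreserving (fun x : carrier => g • x) μ μ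
  free : ∀ᵐ x ∂μ, ∀ g : G, g ≠ 1 → g • x ≠ x

attribute [instance] FreePMPAction.measurableSpace FreePMPAction.standardBorel
  FreePMPAction.action FreePMPAction.isProbabilityMeasure

/-- `x` and `y` are connected by a path of length at most `C` in which each edge is, for some `j`,
an `S j`-edge with both endpoints in `V j`. -/
def ConnectedByPath {G : Type u} [Group G] {X : Type w} [MulAction G X] {n : ℕ}
    (S : Fin n → SymmFinSets G) (V : Fin n → Set X) (C : ℕ) (x y : X) : Prop :=
  ∃ m ≤ C, ∃ p : ℕ → X, p 0 = x ∧ p m = y ∧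
    ∀ i < m, ∃ j : Fin n, p i ∈ V j ∧ p (i + 1) ∈ V j ∧ ∃ s ∈ (S j).1, p (i + 1) = s • p i

/-- Property SC ("sparsely connected") for a class of free p.m.p. actions of `G`. -/
def PropertySC {G : Type u} [Group G] (𝒴 : Set (FreePMPAction.{u, w} G)) : Prop :=
  ∀ Υ : FinSets G → ℝ≥0, ∃ S : SymmFinSets G, ∀ T : SymmFinSets G,
    ∃ (C n : ℕ) (S' : Fin n → SymmFinSets G), ∀ α ∈ 𝒴,
      ∃ (W : Set α.carrier) (V : Fin n → Set α.carrier),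
        MeasurableSet W ∧ (∀ j, MeasurableSet (V j)) ∧
        ∑ j, (Υ (S' j).toFinSets : ℝ≥0∞) * α.μ (V j) ≤ 1 ∧
        (S.1 : Set G) • W = Set.univ ∧
        ∀ w₁ ∈ W, ∀ w₂ ∈ W, ∀ g ∈ T.1, g • w₁ = w₂ → ConnectedByPath S' V C w₁ w₂

section Product

variable (G : Type u) (Γ : Type v) [Group G] [Group Γ]

/-- The product action of `G × Γ` on `X × Y`. -/
abbrev prodMulAction (X Y : Type w) [MulAction G X] [MulAction Γ Y] :
    MulAction (G × Γ) (X × Y) where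
  smul g z := (g.1 • z.1, g.2 • z.2)
  one_smul z := Prod.ext (one_smul G z.1) (one_smul Γ z.2)
  mul_smul g h z := Prod.ext (mul_smul g.1 h.1 z.1) (mul_smul g.2 h.2 z.2)

/-- The product action `G × Γ ↷ (X × Y, μ)` associated with free Borel actions of `G` on `X` and
of `Γ` on `Y` and with an invariant probability measure `μ`. -/
def FreePMPAction.prod (X Y : Type w)
    [MeasurableSpace X] [StandardBorelSpace X] [MulAction G X] [IsCancelSMul G X]
    [MeasurableSpace Y] [StandardBorelSpace Y] [MulAction Γ Y] [IsCancelSMul Γ Y]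
    (μ : Measure (X × Y)) [IsProbabilityMeasure μ]
    (hμ : ∀ (g : G) (γ : Γ), MeasurePreserving (fun z : X × Y => (g • z.1, γ • z.2)) μ μ) :
    FreePMPAction.{max u v, w} (G × Γ) :=
  { carrier := X × Y
    action := prodMulAction G Γ X Y
    μ := μ
    measurePreserving_smul := fun g => hμ g.1 g.2
    free := by
      refine Filter.Eventually.of_forall fun z g hg h => hg ?_
      have h' : (g.1 • z.1, g.2 • z.2) = z := h
      have h1 : g.1 • z.1 = (1 : G) • z.1 := by rw [one_smul]; exact congrArg Prod.fst h'
      have h2 : g.2 • z.2 = (1 : Γ) • z.2 := by rw [one_smul]; exact congrArg Prod.snd h'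
      exact Prod.ext (IsCancelSMul.right_cancel _ _ _ h1) (IsCancelSMul.right_cancel _ _ _ h2) }

/-- The class of all p.m.p. actions of the form `G × Γ ↷ (X × Y, μ)`, where `G ↷ X` and `Γ ↷ Y`
are free Borel actions on standard Borel spaces, `G × Γ` acts by the product action and `μ` is an
invariant Borel probability measure, not necessarily a product measure. -/
def productActions : Set (FreePMPAction.{max u v, w} (G × Γ)) :=
  {α | ∃ (X Y : Type w)
      (_ : MeasurableSpace X) (_ : StandardBorelSpace X) (_ : MulAction G X)
      (_ : MeasurableConstSMul G X) (_ : IsCancelSMul G X)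
      (_ : MeasurableSpace Y) (_ : StandardBorelSpace Y) (_ : MulAction Γ Y)
      (_ : MeasurableConstSMul Γ Y) (_ : IsCancelSMul Γ Y)
      (μ : Measure (X × Y)) (_ : IsProbabilityMeasure μ)
      (hμ : ∀ (g : G) (γ : Γ), MeasurePreserving (fun z : X × Y => (g • z.1, γ • z.2)) μ μ),
      α = FreePMPAction.prod G Γ X Y μ hμ}

/-- `G × Γ` has property SC for product actions. -/
def PropertySCForProductActions : Prop :=
  PropertySC (productActions.{u, v, w} G Γ)

end Product

/-! ### Paths inside invariant sets. -/

section Paths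

variable {K : Type u} [Group K]

/-! Suppose first that `G` is not locally finite, and let a finite A₀ ⊆ G generate an infinite
subgroup. Small markers in Y pull back to small G-invariant sets E₁ and E₃, swept by finite subsets
of Γ. Small markers in X pull back to a small Γ-invariant set E₂, swept by a finite subset of ⟨A₀⟩.
Put W = E₁. To join z to tz, with t = ba, a ∈ G and b ∈ Γ, go by A₀-edges inside E₁ to E₂, cross
along Γ inside E₂ into E₃, perform a inside E₃, and return through E₂ and E₁. Making E₂ smaller
makes its sweeping set larger, but that distance is covered by A₀-edges, so it costs only path
length and never `Υ`. This is `propertySC_of_hasInvariantMarkers`; the other case is symmetric.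

Conversely, if both factors are locally finite, their product is an increasing union of finite
subgroups H i. Let `Υ` grow like 2^i |H i|. With s = |S| and L = H (s+1), edges leaving L live on
sets whose saturations have total measure at most 2^-(s+1). Off these, paths stay in L-orbits, so
taking for T a finite subgroup much larger than L leaves W with measure below 1/s, although SW is
the whole space (`not_propertySC_of_isLocallyFiniteGroup`). The class is nonempty because shifts on
injective Gaussian sequences give free actions. -/

open Classical in
/-- The smallest symmetric set containing `F` and the identity. -/
noncomputable def symmHull (F : Finset K) : SymmFinSets K :=
  ⟨insert 1 (F ∪ F⁻¹), by
    refine ⟨fun g hg => ?_, Finset.mem_insert_self _ _⟩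
    simp only [Finset.mem_insert, Finset.mem_union, Finset.mem_inv', inv_inv, inv_eq_one] at hg ⊢
    tauto⟩

theorem mem_symmHull {F : Finset K} {g : K} (hg : g ∈ F) : g ∈ (symmHull F).1 := by
  simp [symmHull, hg]

variable {Z : Type w} [MulAction K Z] {n : ℕ} {S : Fin n → SymmFinSets K} {V : Fin n → Set Z}

theorem ConnectedByPath.refl (C : ℕ) (x : Z) : ConnectedByPath S V C x x :=
  ⟨0, Nat.zero_le _, fun _ => x, rfl, rfl, fun _ h => absurd h (Nat.not_lt_zero _)⟩

theorem ConnectedByPath.mono {C D : ℕ} {x y : Z} (h : ConnectedByPath S V C x y) (hCD : C ≤ D) :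
    ConnectedByPath S V D x y :=
  let ⟨m, hm, p⟩ := h
  ⟨m, hm.trans hCD, p⟩

theorem ConnectedByPath.symm {C : ℕ} {x y : Z} (h : ConnectedByPath S V C x y) :
    ConnectedByPath S V C y x := by
  obtain ⟨m, hm, p, h0, h1, hp⟩ := h
  refine ⟨m, hm, fun i => p (m - i), by simpa using h1, by simpa using h0, fun i hi => ?_⟩
  obtain ⟨j, hj, hj', s, hs, e⟩ := hp (m - (i + 1)) (by omega)
  have h2 : m - (i + 1) + 1 = m - i := by omega
  rw [h2] at hj' e
  exact ⟨j, hj', hj, s⁻¹, (S j).2.1 s hs, by simp [e]⟩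

theorem ConnectedByPath.trans {C D : ℕ} {x y z : Z} (h : ConnectedByPath S V C x y)
    (h' : ConnectedByPath S V D y z) : ConnectedByPath S V (C + D) x z := by
  obtain ⟨m, hm, p, h0, h1, hp⟩ := h
  obtain ⟨m', hm', q, h0', h1', hq⟩ := h'
  refine ⟨m + m', by omega, fun i => if i ≤ m then p i else q (i - m), by simpa using h0, ?_,
    fun i hi => ?_⟩
  · by_cases hz : m' = 0
    · subst hz
      simp [h1, ← h1', h0']
    · simp [hz, h1']
  · rcases lt_or_ge i m with hlt | hge
    · simpa [hlt.le, Nat.succ_le_of_lt hlt] using hp i hlt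
    · have := hq (i - m) (by omega)
      -- At the seam i = m the definition reads p, which agrees there with q 0.
      have e1 : (if i ≤ m then p i else q (i - m)) = q (i - m) := by
        split_ifs with hc
        · obtain rfl : i = m := le_antisymm hc hge
          simp [h1, h0']
        · rfl
      have e2 : i + 1 - m = i - m + 1 := by omega
      simpa only [e1, if_neg (show ¬ i + 1 ≤ m by omega), e2] using this

theorem ConnectedByPath.edge (j : Fin n) {x : Z} {s : K} (hs : s ∈ (S j).1) (hx : x ∈ V j)
    (hy : s • x ∈ V j) : ConnectedByPath S V 1 x (s • x) := by
  refine ⟨1, le_rfl, fun i => if i = 0 then x else s • x, by simp, by simp, fun i hi => ?_⟩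
  obtain rfl : i = 0 := by omega
  exact ⟨j, by simpa using hx, by simpa using hy, s, hs, by simp⟩

/-- Inside an invariant set, moving by an element of the group generated by `A` takes a bounded
number of `A`-edges, uniformly over all actions. -/
theorem exists_connectedByPath_of_mem_closure (A : Finset K) {h : K}
    (hh : h ∈ Subgroup.closure (A : Set K)) :
    ∃ N : ℕ, ∀ (Z : Type w) [MulAction K Z] (n : ℕ) (S : Fin n → SymmFinSets K)
      (V : Fin n → Set Z) (j : Fin n), A ⊆ (S j).1 →
      (∀ a ∈ Subgroup.closure (A : Set K), ∀ z ∈ V j, a • z ∈ V j) →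
      ∀ z ∈ V j, ConnectedByPath S V N z (h • z) := by
  induction hh using Subgroup.closure_induction with
  | mem a ha =>
    exact ⟨1, fun Z _ n S V j hA hV z hz =>
      .edge j (hA ha) hz (hV a (Subgroup.subset_closure ha) z hz)⟩
  | one => exact ⟨0, fun Z _ n S V j hA hV z hz => by simpa using ConnectedByPath.refl 0 z⟩
  | mul a b ha hb iha ihb =>
    obtain ⟨N, hN⟩ := iha
    obtain ⟨M, hM⟩ := ihb
    refine ⟨M + N, fun Z _ n S V j hA hV z hz => ?_⟩
    rw [mul_smul]
    exact (hM Z n S V j hA hV z hz).trans (hN Z n S V j hA hV _ (hV b hb z hz))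
  | inv a ha iha =>
    obtain ⟨N, hN⟩ := iha
    refine ⟨N, fun Z _ n S V j hA hV z hz => ?_⟩
    have := (hN Z n S V j hA hV _ (hV _ (inv_mem ha) z hz)).symm
    rwa [smul_inv_smul] at this

theorem exists_connectedByPath_of_subset_closure (A F : Finset K)
    (hF : (F : Set K) ⊆ Subgroup.closure (A : Set K)) :
    ∃ N : ℕ, ∀ h ∈ F, ∀ (Z : Type w) [MulAction K Z] (n : ℕ) (S : Fin n → SymmFinSets K)
      (V : Fin n → Set Z) (j : Fin n), A ⊆ (S j).1 →
      (∀ a ∈ Subgroup.closure (A : Set K), ∀ z ∈ V j, a • z ∈ V j) →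
      ∀ z ∈ V j, ConnectedByPath S V N z (h • z) := by
  choose! N hN using fun (h : K) (hh : h ∈ F) =>
    exists_connectedByPath_of_mem_closure.{u, w} A (hF hh)
  exact ⟨F.sup N, fun h hh Z _ n S V j hA hV z hz =>
    (hN h hh Z n S V j hA hV z hz).mono (Finset.le_sup hh)⟩

end Paths

/-! ### Sufficient criterion: two commuting directions with invariant markers. -/

section Criterion

variable {K : Type u} [Group K]

/-- A class of actions has `F`-sweeping sets of arbitrarily small measure, with `F` a subset of `D`
not depending on the action, which are invariant under `A`. -/
def HasInvariantMarkers (𝒴 : Set (FreePMPAction.{u, w} K)) (A : Subgroup K) (D : Set K) : Prop :=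
  ∀ ε : ℝ≥0∞, ε ≠ 0 → ∃ F : Finset K, (F : Set K) ⊆ D ∧ ∀ α ∈ 𝒴, ∃ E : Set α.carrier,
    MeasurableSet E ∧ α.μ E ≤ ε ∧ (∀ z : α.carrier, ∃ f ∈ F, f • z ∈ E) ∧
      ∀ a ∈ A, ∀ z ∈ E, a • z ∈ E

theorem exists_pos_mul_le_third (c : ℝ≥0) :
    ∃ ε : ℝ≥0∞, ε ≠ 0 ∧ ∀ t ≤ ε, (c : ℝ≥0∞) * t ≤ 1 / 3 := by
  refine ⟨1 / (3 * (c + 1)), by simp [ENNReal.mul_eq_top], fun t ht => ?_⟩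
  have hc : ((c : ℝ≥0∞) + 1) * (1 / (3 * (c + 1))) = 1 / 3 := by
    rw [one_div, ENNReal.mul_inv (by simp) (by simp), mul_comm (3⁻¹ : ℝ≥0∞), ← mul_assoc,
      ENNReal.mul_inv_cancel (by simp) (by simp), one_mul, one_div]
  exact (mul_le_mul' le_self_add ht).trans hc.le

/-- If `K` is the product of commuting subgroups `A` and `B`, then a class of actions with
`A`-invariant markers along `B` and `B`-invariant markers along a finitely generated subgroup of `A`
has property SC. -/
theorem propertySC_of_hasInvariantMarkers (𝒴 : Set (FreePMPAction.{u, w} K)) (A B : Subgroup K)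
    (hcomm : ∀ a ∈ A, ∀ b ∈ B, a * b = b * a) (hAB : ∀ k : K, ∃ a ∈ A, ∃ b ∈ B, b * a = k)
    (A₀ : Finset K) (hA₀ : Subgroup.closure (A₀ : Set K) ≤ A)
    (hA : HasInvariantMarkers 𝒴 A B)
    (hB : HasInvariantMarkers 𝒴 B (Subgroup.closure (A₀ : Set K))) :
    PropertySC 𝒴 := by
  classical
  intro Υ
  choose a ha b hb hab using hAB
  -- `S` and W must precede `T`, so the edges allowed on E₁ are those of A₀ alone.
  set S₁ := symmHull A₀
  obtain ⟨ε₁, hε₁, hΥ₁⟩ := exists_pos_mul_le_third (Υ S₁.toFinSets)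
  obtain ⟨F₁, -, hE₁⟩ := hA ε₁ hε₁
  refine ⟨symmHull F₁, fun T => ?_⟩
  set S₃ := symmHull (A₀ ∪ T.1.image a)
  obtain ⟨ε₃, hε₃, hΥ₃⟩ := exists_pos_mul_le_third (Υ S₃.toFinSets)
  obtain ⟨F₃, hF₃, hE₃⟩ := hA ε₃ hε₃
  -- Choosing E₂ last is possible because F₂ affects no edge set, only the length N. The elements b
  -- t * d⁻¹ undo the crossing by d and perform the B-part of t in one edge.
  set S₂ := symmHull (F₃ ∪ (T.1 ×ˢ F₃).image fun p => b p.1 * p.2⁻¹)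
  obtain ⟨ε₂, hε₂, hΥ₂⟩ := exists_pos_mul_le_third (Υ S₂.toFinSets)
  obtain ⟨F₂, hF₂, hE₂⟩ := hB ε₂ hε₂
  obtain ⟨N, hN⟩ := exists_connectedByPath_of_subset_closure.{u, w} A₀ F₂ hF₂
  refine ⟨N + 1 + N + 1 + N + 1 + N, 3, ![S₁, S₂, S₃], fun α hα => ?_⟩
  obtain ⟨E₁, mE₁, μE₁, sE₁, iE₁⟩ := hE₁ α hα
  obtain ⟨E₂, mE₂, μE₂, sE₂, iE₂⟩ := hE₂ α hα
  obtain ⟨E₃, mE₃, μE₃, sE₃, iE₃⟩ := hE₃ α hα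
  refine ⟨E₁, ![E₁, E₂, E₃], mE₁, ?_, ?_, ?_, ?_⟩
  · intro j
    fin_cases j
    exacts [mE₁, mE₂, mE₃]
  · rw [Fin.sum_univ_three]
    refine (add_le_add (add_le_add (hΥ₁ _ μE₁) (hΥ₂ _ μE₂)) (hΥ₃ _ μE₃)).trans ?_
    exact (ENNReal.add_thirds 1).le
  · refine Set.eq_univ_of_forall fun z => ?_
    obtain ⟨f, hf, hz⟩ := sE₁ z
    exact ⟨f⁻¹, (symmHull F₁).2.1 f (mem_symmHull hf), f • z, hz, inv_smul_smul f z⟩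
  · rintro z hz _ hw t ht rfl
    obtain ⟨h, hh, hz₂⟩ := sE₂ z
    obtain ⟨d, hd, hz₃⟩ := sE₃ z
    obtain ⟨h', hh', hz₂'⟩ := sE₂ (a t • z)
    have hA' := hA₀ (hF₂ hh)
    have hA'' := hA₀ (hF₂ hh')
    have hdB := hF₃ hd
    have inv₁ : ∀ g ∈ Subgroup.closure (A₀ : Set K), ∀ z ∈ (![E₁, E₂, E₃] : Fin 3 → _) 0,
        g • z ∈ (![E₁, E₂, E₃] : Fin 3 → _) 0 := fun g hg => iE₁ g (hA₀ hg)
    have inv₃ : ∀ g ∈ Subgroup.closure (A₀ : Set K), ∀ z ∈ (![E₁, E₂, E₃] : Fin 3 → _) 2,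
        g • z ∈ (![E₁, E₂, E₃] : Fin 3 → _) 2 := fun g hg => iE₃ g (hA₀ hg)
    have sub₁ : A₀ ⊆ (![S₁, S₂, S₃] 0).1 := fun g hg => mem_symmHull hg
    have sub₃ : A₀ ⊆ (![S₁, S₂, S₃] 2).1 :=
      fun g hg => mem_symmHull (Finset.mem_union_left _ hg)
    -- The path is z → hz in E₁, → dhz in E₂, → dz → a dz → h'a dz in E₃, → bh'a z in E₂, → tz in
    -- E₁. Commutation identifies the endpoints of successive pieces.
    have p₁ := hN h hh _ 3 ![S₁, S₂, S₃] ![E₁, E₂, E₃] 0 sub₁ inv₁ z hz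
    have p₂ : ConnectedByPath ![S₁, S₂, S₃] ![E₁, E₂, E₃] 1 (h • z) (d • h • z) :=
      .edge 1 (mem_symmHull (Finset.mem_union_left _ hd)) hz₂ (iE₂ d hdB _ hz₂)
    have p₃ := (hN h hh _ 3 ![S₁, S₂, S₃] ![E₁, E₂, E₃] 2 sub₃ inv₃ (d • z) hz₃).symm
    rw [← mul_smul, hcomm h hA' d hdB, mul_smul] at p₃
    have p₄ : ConnectedByPath ![S₁, S₂, S₃] ![E₁, E₂, E₃] 1 (d • z) (a t • d • z) :=
      .edge 2 (mem_symmHull (Finset.mem_union_right _ (Finset.mem_image_of_mem a ht))) hz₃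
        (iE₃ _ (ha t) _ hz₃)
    have p₅ := hN h' hh' _ 3 ![S₁, S₂, S₃] ![E₁, E₂, E₃] 2 sub₃ inv₃ (a t • d • z)
      (iE₃ _ (ha t) _ hz₃)
    have e₅ : h' • a t • d • z = d • h' • a t • z := by
      simp only [← mul_smul]
      rw [hcomm _ (ha t) d hdB, ← mul_assoc, hcomm h' hA'' d hdB, mul_assoc]
    rw [e₅] at p₅
    have e₆ : (b t * d⁻¹) • d • h' • a t • z = b t • h' • a t • z := by simp [mul_smul]
    have p₆ : ConnectedByPath ![S₁, S₂, S₃] ![E₁, E₂, E₃] 1 (d • h' • a t • z)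
        ((b t * d⁻¹) • d • h' • a t • z) := by
      refine .edge 1 (mem_symmHull (Finset.mem_union_right _ (Finset.mem_image.2
        ⟨(t, d), Finset.mk_mem_product ht hd, rfl⟩))) (iE₂ d hdB _ hz₂') ?_
      rw [e₆]
      exact iE₂ _ (hb t) _ hz₂'
    rw [e₆] at p₆
    have p₇ := (hN h' hh' _ 3 ![S₁, S₂, S₃] ![E₁, E₂, E₃] 0 sub₁ inv₁ (t • z) hw).symm
    have e₇ : h' • t • z = b t • h' • a t • z := by
      conv_lhs => rw [← hab t]
      simp only [← mul_smul]
      rw [← mul_assoc, hcomm h' hA'' _ (hb t), mul_assoc]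
    rw [e₇] at p₇
    exact (((((p₁.trans p₂).trans p₃).trans p₄).trans p₅).trans p₆).trans p₇

end Criterion

/-! ### A double-counting bound on measures. -/

section Counting

variable {K : Type u} [Group K]

/-- If almost every orbit map sends at most `L` elements of `P` into `E`, then `|P| μ(E) ≤ L`. -/
theorem FreePMPAction.card_mul_measure_le (α : FreePMPAction.{u, w} K) {E : Set α.carrier}
    (hE : MeasurableSet E) (P : Finset K) (L : ℕ)
    (h : ∀ᵐ z ∂α.μ, ∀ A ⊆ P, (∀ g ∈ A, g • z ∈ E) → A.card ≤ L) : (P.card : ℝ≥0∞) * α.μ E ≤ L := by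
  classical
  have hm : ∀ g : K, MeasurableSet ((fun z : α.carrier => g • z) ⁻¹' E) := fun g =>
    (α.measurePreserving_smul g).measurable hE
  calc (P.card : ℝ≥0∞) * α.μ E
      = ∑ g ∈ P, ∫⁻ z, ((fun z : α.carrier => g • z) ⁻¹' E).indicator 1 z ∂α.μ := by
        rw [Finset.sum_congr rfl fun g _ => by
          rw [lintegral_indicator_one (hm g),
            (α.measurePreserving_smul g).measure_preimage hE.nullMeasurableSet]]
        simp
    _ = ∫⁻ z, ∑ g ∈ P, ((fun z : α.carrier => g • z) ⁻¹' E).indicator 1 z ∂α.μ :=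
        (lintegral_finsetSum _ fun g _ => measurable_one.indicator (hm g)).symm
    _ ≤ ∫⁻ _, (L : ℝ≥0∞) ∂α.μ := by
        refine lintegral_mono_ae (h.mono fun z hz => ?_)
        have : ∑ g ∈ P, ((fun z : α.carrier => g • z) ⁻¹' E).indicator (1 : α.carrier → ℝ≥0∞) z =
            ((P.filter fun g => g • z ∈ E).card : ℝ≥0∞) := by
          simp [Set.indicator_apply]
        rw [this]
        exact_mod_cast hz _ (Finset.filter_subset _ _) fun g hg => (Finset.mem_filter.1 hg).2
    _ = L := by simp

end Counting

/-! ### Borel maximal independent sets. -/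

section Markers

variable {G : Type u} [Group G] {X : Type w} [MeasurableSpace X] [StandardBorelSpace X]
  [MulAction G X] [MeasurableConstSMul G X] [IsCancelSMul G X]

/-- A standard Borel space carrying a free Borel action is covered by countably many Borel sets
each disjoint from its translates by the nontrivial elements of a given finite set. -/
theorem exists_countable_cover_disjoint_smul (D : Finset G) :
    ∃ U : ℕ → Set X, (∀ n, MeasurableSet (U n)) ∧ (∀ x, ∃ n, x ∈ U n) ∧
      ∀ n, ∀ g ∈ D, g ≠ 1 → ∀ x ∈ U n, g • x ∉ U n := by
  classical
  obtain ⟨f, hf⟩ := exists_measurableEmbedding_real X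
  let Q : ℚ × Bool → Set ℝ := fun p => if p.2 then Set.Iio (p.1 : ℝ) else Set.Ioi (p.1 : ℝ)
  have hQ : ∀ p, MeasurableSet (Q p) := by
    rintro ⟨q, _ | _⟩
    exacts [measurableSet_Ioi, measurableSet_Iio]
  have sep : ∀ a b : ℝ, a ≠ b → ∃ p, a ∈ Q p ∧ b ∉ Q p := by
    intro a b hab
    rcases lt_or_gt_of_ne hab with h | h
    · obtain ⟨q, h1, h2⟩ := exists_rat_btwn h
      exact ⟨(q, true), by simpa [Q] using h1, by simpa [Q] using h2.le⟩
    · obtain ⟨q, h1, h2⟩ := exists_rat_btwn h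
      exact ⟨(q, false), by simpa [Q] using h2, by simpa [Q] using h1.le⟩
  let D' := D.erase 1
  -- The index c picks, for each g, a rational half-line containing f x but not f (g • x); there are
  -- countably many choices.
  let U : (D' → ℚ × Bool) → Set X := fun c =>
    ⋂ g : D', (f ⁻¹' Q (c g)) ∩ ((fun x : X => (g : G) • x) ⁻¹' (f ⁻¹' Q (c g)))ᶜ
  obtain ⟨e, he⟩ := exists_surjective_nat (D' → ℚ × Bool)
  refine ⟨fun n => U (e n), fun n => ?_, fun x => ?_, fun n g hg hg1 x hx hgx => ?_⟩
  · exact .iInter fun g => (hf.measurable (hQ _)).inter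
      (measurable_const_smul (g : G) (hf.measurable (hQ _))).compl
  · have : ∀ g : D', ∃ p, f x ∈ Q p ∧ f ((g : G) • x) ∉ Q p := fun g => by
      refine sep _ _ fun h => (Finset.mem_erase.1 g.2).1 ?_
      refine IsCancelSMul.right_cancel _ _ x ?_
      rw [one_smul]
      exact (hf.injective h).symm
    choose c hc using this
    obtain ⟨n, hn⟩ := he c
    exact ⟨n, Set.mem_iInter.2 fun g => by rw [hn]; exact hc g⟩
  · have hgD : g ∈ D' := Finset.mem_erase.2 ⟨hg1, hg⟩
    exact (Set.mem_iInter.1 hx ⟨g, hgD⟩).2 (Set.mem_iInter.1 hgx ⟨g, hgD⟩).1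

/-- For a free Borel action and a finite symmetric set `D` there is a Borel maximal `D`-independent
set. -/
theorem exists_maximal_independent (D : Finset G) (hD : ∀ g ∈ D, g⁻¹ ∈ D) :
    ∃ B : Set X, MeasurableSet B ∧ (∀ g ∈ D, g ≠ 1 → ∀ x ∈ B, g • x ∉ B) ∧
      ∀ x, x ∈ B ∨ ∃ g ∈ D, g • x ∈ B := by
  obtain ⟨U, mU, cU, iU⟩ := exists_countable_cover_disjoint_smul (X := X) D
  -- Greedy construction: stage n adds all points of U n with no D-neighbour chosen so far. They can
  -- be added together since U n is itself independent.
  let A : ℕ → Set X := fun n => Nat.rec ∅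
    (fun n A => A ∪ (U n ∩ (⋃ g ∈ D, (fun x : X => g • x) ⁻¹' A)ᶜ)) n
  have hA : ∀ n x, x ∈ A (n + 1) ↔ x ∈ A n ∨ x ∈ U n ∧ ∀ g ∈ D, g • x ∉ A n := fun n x => by
    simp [A]
  have mA : ∀ n, MeasurableSet (A n) := fun n => by
    induction n with
    | zero => exact .empty
    | succ n ih =>
      exact ih.union ((mU n).inter (D.measurableSet_biUnion fun g _ =>
        measurable_const_smul g ih).compl)
  have iA : ∀ n, ∀ g ∈ D, g ≠ 1 → ∀ x ∈ A n, g • x ∉ A n := fun n => by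
    induction n with
    | zero => exact fun g _ _ x hx => absurd hx (Set.notMem_empty x)
    | succ n ih =>
      intro g hg hg1 x hx hgx
      rw [hA] at hx hgx
      rcases hx with hx | ⟨hx, hx'⟩ <;> rcases hgx with hgx | ⟨hgx, hgx'⟩
      · exact ih g hg hg1 x hx hgx
      · exact hgx' g⁻¹ (hD g hg) (by rwa [inv_smul_smul])
      · exact hx' g hg hgx
      · exact iU n g hg hg1 x hx hgx
  have monoA : Monotone A := monotone_nat_of_le_succ fun n x hx => (hA n x).2 (.inl hx)
  refine ⟨⋃ n, A n, .iUnion mA, fun g hg hg1 x hx hgx => ?_, fun x => ?_⟩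
  · obtain ⟨n, hn⟩ := Set.mem_iUnion.1 hx
    obtain ⟨m, hm⟩ := Set.mem_iUnion.1 hgx
    exact iA (max n m) g hg hg1 x (monoA (le_max_left _ _) hn) (monoA (le_max_right _ _) hm)
  · obtain ⟨n, hn⟩ := cU x
    rcases Classical.em (∀ g ∈ D, g • x ∉ A n) with h | h
    · exact .inl (Set.mem_iUnion.2 ⟨n + 1, (hA n x).2 (.inr ⟨hn, h⟩)⟩)
    · push Not at h
      obtain ⟨g, hg, hx⟩ := h
      exact .inr ⟨g, hg, Set.mem_iUnion.2 ⟨n, hx⟩⟩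

end Markers

/-! ### Markers for product actions and the non-locally-finite case. -/

section Product

/-- An infinite subgroup has finite subsets `P` of any size, and `F`, such that every free Borel
action has a Borel set whose `P`-translates are disjoint and which every `F`-orbit meets. -/
theorem exists_marker_sets {G : Type u} [Group G] (H : Subgroup G) [Infinite H] (N : ℕ) :
    ∃ P F : Finset G, P.card = N ∧ (F : Set G) ⊆ H ∧
      ∀ (X : Type w) [MeasurableSpace X] [StandardBorelSpace X] [MulAction G X]
        [MeasurableConstSMul G X] [IsCancelSMul G X], ∃ B : Set X, MeasurableSet B ∧
        (∀ g ∈ P, ∀ h ∈ P, ∀ x : X, g • x ∈ B → h • x ∈ B → g = h) ∧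
        ∀ x : X, ∃ f ∈ F, f • x ∈ B := by
  classical
  obtain ⟨P, hPH, hP⟩ := (Set.infinite_coe_iff.1 ‹Infinite H›).exists_subset_card_eq N
  -- If gx and hx both lie in B, then gh⁻¹ moves one point of B to another, so D-independence forces
  -- g = h.
  let D := (P ×ˢ P).image fun p => p.1 * p.2⁻¹
  have hD : ∀ g ∈ D, g⁻¹ ∈ D := by
    intro g hg
    obtain ⟨⟨a, b⟩, hp, rfl⟩ := Finset.mem_image.1 hg
    rw [Finset.mem_product] at hp
    exact Finset.mem_image.2 ⟨(b, a), Finset.mem_product.2 hp.symm, by simp⟩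
  refine ⟨P, insert 1 D, hP, ?_, fun X _ _ _ _ _ => ?_⟩
  · intro g hg
    rcases Finset.mem_insert.1 hg with rfl | hg
    · exact one_mem H
    · obtain ⟨⟨a, b⟩, hp, rfl⟩ := Finset.mem_image.1 hg
      rw [Finset.mem_product] at hp
      exact mul_mem (hPH hp.1) (inv_mem (hPH hp.2))
  · obtain ⟨B, mB, iB, cB⟩ := exists_maximal_independent (X := X) D hD
    refine ⟨B, mB, fun g hg h hh x hgx hhx => ?_, fun x => ?_⟩
    · by_contra hne
      refine iB (g * h⁻¹) (Finset.mem_image.2 ⟨(g, h), Finset.mk_mem_product hg hh, rfl⟩)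
        (fun e => hne (mul_inv_eq_one.1 e)) _ hhx ?_
      rwa [mul_smul, inv_smul_smul]
    · rcases cB x with h | ⟨g, hg, h⟩
      · exact ⟨1, Finset.mem_insert_self _ _, by rwa [one_smul]⟩
      · exact ⟨g, Finset.mem_insert_of_mem hg, h⟩

theorem FreePMPAction.measure_le_of_pairwise_disjoint {K : Type u} [Group K]
    (α : FreePMPAction.{u, w} K) {E : Set α.carrier} (hE : MeasurableSet E) (P : Finset K)
    (h : ∀ g ∈ P, ∀ k ∈ P, ∀ z : α.carrier, g • z ∈ E → k • z ∈ E → g = k) {ε : ℝ≥0∞}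
    (hε : (P.card : ℝ≥0∞)⁻¹ ≤ ε) : α.μ E ≤ ε := by
  refine le_trans ?_ hε
  rw [← one_div, ENNReal.le_div_iff_mul_le (by simp) (by simp), mul_comm]
  refine (α.card_mul_measure_le hE P 1
    (Filter.Eventually.of_forall fun z A hA hz => ?_)).trans (by simp)
  exact Finset.card_le_one.2 fun g hg k hk => h g (hA hg) k (hA hk) z (hz g hg) (hz k hk)

variable (G : Type u) (Γ : Type v) [Group G] [Group Γ]

/-- A set pulled back from X is automatically Γ-invariant, and its measure is bounded by
disjointness of translates alone. Hence nothing about μ beyond invariance is needed. -/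
theorem hasInvariantMarkers_left (H : Subgroup G) [Infinite H] :
    HasInvariantMarkers (productActions.{u, v, w} G Γ) (MonoidHom.inr G Γ).range
      (H.map (MonoidHom.inl G Γ)) := by
  intro ε hε
  obtain ⟨N, hN⟩ := ENNReal.exists_inv_nat_lt hε
  obtain ⟨P, F, hP, hF, hB⟩ := exists_marker_sets.{u, w} H N
  refine ⟨F.map ⟨MonoidHom.inl G Γ, fun _ _ h => congrArg Prod.fst h⟩, ?_, ?_⟩
  · intro g hg
    obtain ⟨f, hf, rfl⟩ := Finset.mem_map.1 hg
    exact ⟨f, hF hf, rfl⟩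
  rintro _ ⟨X, Y, _, _, _, _, _, _, _, _, _, _, μ, _, hμ, rfl⟩
  obtain ⟨B, mB, dB, cB⟩ := hB X
  have mE : MeasurableSet {z : X × Y | z.1 ∈ B} := measurable_fst mB
  refine ⟨{z : X × Y | z.1 ∈ B}, mE, ?_, fun z => ?_, ?_⟩
  · refine FreePMPAction.measure_le_of_pairwise_disjoint
      (FreePMPAction.prod G Γ X Y μ hμ) mE (P.map ⟨MonoidHom.inl G Γ, fun _ _ h => congrArg Prod.fst h⟩)
      ?_ (by simpa [hP] using hN.le)
    intro _ hg' _ hk' z hgz hkz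
    obtain ⟨g, hg, rfl⟩ := Finset.mem_map.1 hg'
    obtain ⟨k, hk, rfl⟩ := Finset.mem_map.1 hk'
    exact congrArg _ (dB g hg k hk z.1 hgz hkz)
  · obtain ⟨f, hf, h⟩ := cB z.1
    exact ⟨_, Finset.mem_map_of_mem _ hf, h⟩
  · rintro _ ⟨γ, rfl⟩ z hz
    exact show (1 : G) • z.1 ∈ B by rwa [one_smul]

theorem hasInvariantMarkers_right (H : Subgroup Γ) [Infinite H] :
    HasInvariantMarkers (productActions.{u, v, w} G Γ) (MonoidHom.inl G Γ).range
      (H.map (MonoidHom.inr G Γ)) := by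
  intro ε hε
  obtain ⟨N, hN⟩ := ENNReal.exists_inv_nat_lt hε
  obtain ⟨P, F, hP, hF, hB⟩ := exists_marker_sets.{v, w} H N
  refine ⟨F.map ⟨MonoidHom.inr G Γ, fun _ _ h => congrArg Prod.snd h⟩, ?_, ?_⟩
  · intro g hg
    obtain ⟨f, hf, rfl⟩ := Finset.mem_map.1 hg
    exact ⟨f, hF hf, rfl⟩
  rintro _ ⟨X, Y, _, _, _, _, _, _, _, _, _, _, μ, _, hμ, rfl⟩
  obtain ⟨B, mB, dB, cB⟩ := hB Y
  have mE : MeasurableSet {z : X × Y | z.2 ∈ B} := measurable_snd mB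
  refine ⟨{z : X × Y | z.2 ∈ B}, mE, ?_, fun z => ?_, ?_⟩
  · refine FreePMPAction.measure_le_of_pairwise_disjoint
      (FreePMPAction.prod G Γ X Y μ hμ) mE (P.map ⟨MonoidHom.inr G Γ, fun _ _ h => congrArg Prod.snd h⟩)
      ?_ (by simpa [hP] using hN.le)
    intro _ hg' _ hk' z hgz hkz
    obtain ⟨g, hg, rfl⟩ := Finset.mem_map.1 hg'
    obtain ⟨k, hk, rfl⟩ := Finset.mem_map.1 hk'
    exact congrArg _ (dB g hg k hk z.2 hgz hkz)
  · obtain ⟨f, hf, h⟩ := cB z.2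
    exact ⟨_, Finset.mem_map_of_mem _ hf, h⟩
  · rintro _ ⟨γ, rfl⟩ z hz
    exact show (1 : Γ) • z.2 ∈ B by rwa [one_smul]

variable {G Γ}

theorem exists_infinite_closure_of_not_isLocallyFiniteGroup (h : ¬ IsLocallyFiniteGroup G) :
    ∃ A : Finset G, Infinite (Subgroup.closure (A : Set G)) := by
  unfold IsLocallyFiniteGroup at h
  push Not at h
  obtain ⟨_, ⟨A, rfl⟩, hA⟩ := h
  exact ⟨A, hA⟩

theorem propertySC_of_not_isLocallyFiniteGroup_left [Infinite Γ] (h : ¬ IsLocallyFiniteGroup G) :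
    PropertySCForProductActions.{u, v, w} G Γ := by
  classical
  obtain ⟨A, hA⟩ := exists_infinite_closure_of_not_isLocallyFiniteGroup h
  have hcl : Subgroup.closure ((A.image (MonoidHom.inl G Γ) : Finset (G × Γ)) : Set (G × Γ)) =
      (Subgroup.closure (A : Set G)).map (MonoidHom.inl G Γ) := by
    rw [Finset.coe_image, MonoidHom.map_closure]
  refine propertySC_of_hasInvariantMarkers _ (MonoidHom.inl G Γ).range (MonoidHom.inr G Γ).range
    ?_ (fun k => ⟨(k.1, 1), ⟨k.1, rfl⟩, (1, k.2), ⟨k.2, rfl⟩, by ext <;> simp⟩)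
    (A.image (MonoidHom.inl G Γ)) ?_ ?_ ?_
  · rintro _ ⟨a, rfl⟩ _ ⟨b, rfl⟩
    simp
  · rw [hcl, MonoidHom.range_eq_map]
    exact Subgroup.map_mono le_top
  · rw [MonoidHom.range_eq_map (MonoidHom.inr G Γ)]
    have : Infinite (⊤ : Subgroup Γ) := Subgroup.topEquiv.symm.toEquiv.infinite_iff.1 ‹_›
    exact hasInvariantMarkers_right G Γ ⊤
  · rw [hcl]
    exact hasInvariantMarkers_left G Γ _

theorem propertySC_of_not_isLocallyFiniteGroup_right [Infinite G]
    (h : ¬ IsLocallyFiniteGroup Γ) : PropertySCForProductActions.{u, v, w} G Γ := by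
  classical
  obtain ⟨A, hA⟩ := exists_infinite_closure_of_not_isLocallyFiniteGroup h
  have hcl : Subgroup.closure ((A.image (MonoidHom.inr G Γ) : Finset (G × Γ)) : Set (G × Γ)) =
      (Subgroup.closure (A : Set Γ)).map (MonoidHom.inr G Γ) := by
    rw [Finset.coe_image, MonoidHom.map_closure]
  refine propertySC_of_hasInvariantMarkers _ (MonoidHom.inr G Γ).range (MonoidHom.inl G Γ).range
    ?_ (fun k => ⟨(1, k.2), ⟨k.2, rfl⟩, (k.1, 1), ⟨k.1, rfl⟩, by ext <;> simp⟩)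
    (A.image (MonoidHom.inr G Γ)) ?_ ?_ ?_
  · rintro _ ⟨a, rfl⟩ _ ⟨b, rfl⟩
    simp
  · rw [hcl, MonoidHom.range_eq_map]
    exact Subgroup.map_mono le_top
  · rw [MonoidHom.range_eq_map (MonoidHom.inl G Γ)]
    have : Infinite (⊤ : Subgroup G) := Subgroup.topEquiv.symm.toEquiv.infinite_iff.1 ‹_›
    exact hasInvariantMarkers_left G Γ ⊤
  · rw [hcl]
    exact hasInvariantMarkers_right G Γ _

end Product

/-! ### Failure of SC for locally finite groups. -/

section LocallyFinite

variable {K : Type u} [Group K]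

theorem FreePMPAction.one_le_card_mul_measure (α : FreePMPAction.{u, w} K) (S : SymmFinSets K)
    {W : Set α.carrier} (hW : MeasurableSet W) (h : (S.1 : Set K) • W = Set.univ) :
    1 ≤ (S.1.card : ℝ≥0∞) * α.μ W := by
  have hsub : (Set.univ : Set α.carrier) ⊆ ⋃ s ∈ S.1, (fun z => s • z) ⁻¹' W := by
    intro z _
    have hz : z ∈ (S.1 : Set K) • W := h ▸ Set.mem_univ z
    obtain ⟨s, hs, w, hw, rfl⟩ := hz
    exact Set.mem_biUnion (S.2.1 s hs) (by simpa using hw)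
  calc 1 = α.μ Set.univ := measure_univ.symm
    _ ≤ ∑ s ∈ S.1, α.μ ((fun z => s • z) ⁻¹' W) :=
        (measure_mono hsub).trans (measure_biUnion_finset_le _ _)
    _ = S.1.card * α.μ W := by
        rw [Finset.sum_congr rfl fun s _ =>
          (α.measurePreserving_smul s).measure_preimage hW.nullMeasurableSet]
        simp

/-- If the edges from outside a subgroup `L` avoid the orbit of `x` under the subgroups they
generate, then every path from `x` stays in the `L`-orbit of `x`. -/
theorem ConnectedByPath.exists_smul_eq {Z : Type w} [MulAction K Z] {n : ℕ}
    {S : Fin n → SymmFinSets K} {V : Fin n → Set Z} {C : ℕ} {x y : Z}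
    (h : ConnectedByPath S V C x y) (L : Subgroup K)
    (hL : ∀ j, ((S j).1 : Set K) ⊆ L ∨ ∀ l ∈ L, l • x ∉ V j) : ∃ l ∈ L, y = l • x := by
  obtain ⟨m, -, p, h0, rfl, hp⟩ := h
  have key : ∀ i ≤ m, ∃ l ∈ L, p i = l • x := by
    intro i
    induction i with
    | zero => exact fun _ => ⟨1, one_mem L, by rw [h0, one_smul]⟩
    | succ i ih =>
      intro hi
      obtain ⟨l, hl, e⟩ := ih (by omega)
      obtain ⟨j, hj, -, s, hs, e'⟩ := hp i (by omega)
      rcases hL j with hS | hV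
      · exact ⟨s * l, mul_mem (hS hs) hl, by rw [e', e, mul_smul]⟩
      · exact absurd (e ▸ hj) (hV l hl)
  exact key m le_rfl

/-- A countable locally finite group is an increasing union of finite subgroups. -/
theorem IsLocallyFiniteGroup.exists_monotone_exhaustion [Countable K]
    (hK : IsLocallyFiniteGroup K) : ∃ H : ℕ → Subgroup K, Monotone H ∧ (∀ i, Finite (H i)) ∧
      ∀ F : Finset K, ∃ i, (F : Set K) ⊆ H i := by
  classical
  obtain ⟨e, he⟩ := exists_surjective_nat K
  have mono : Monotone fun i => Subgroup.closure (((Finset.range i).image e : Finset K) : Set K) :=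
    fun i j hij => Subgroup.closure_mono
      (Finset.coe_subset.2 (Finset.image_subset_image (Finset.range_mono hij)))
  refine ⟨_, mono, fun i => hK _ ⟨_, rfl⟩, fun F => ?_⟩
  choose c hc using he
  refine ⟨F.sup c + 1, fun g hg => Subgroup.subset_closure ?_⟩
  exact Finset.mem_image.2 ⟨c g, Finset.mem_range.2 (Nat.lt_succ_of_le (Finset.le_sup hg)), hc g⟩

/-- No nonempty class of free p.m.p. actions of a countably infinite locally finite group has
property SC. -/
theorem not_propertySC_of_isLocallyFiniteGroup [Countable K] [Infinite K]
    (hK : IsLocallyFiniteGroup K) (𝒴 : Set (FreePMPAction.{u, w} K)) (h𝒴 : 𝒴.Nonempty) :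
    ¬ PropertySC 𝒴 := by
  classical
  intro hSC
  obtain ⟨H, Hmono, Hfin, Hex⟩ := hK.exists_monotone_exhaustion
  -- In the `Υ` built from ι, the cardinality pays for saturating V j under H (ι (S' j)), and the
  -- power of 2 makes the saturations with large index small.
  let ι : Finset K → ℕ := fun F => Nat.find (Hex F)
  have hι : ∀ F : Finset K, (F : Set K) ⊆ H (ι F) := fun F => Nat.find_spec (Hex F)
  obtain ⟨S, hS⟩ := hSC fun F => 2 ^ ι F.1 * (Nat.card (H (ι F.1)) : ℝ≥0)
  set s := S.1.card
  let L := H (s + 1)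
  set l := Nat.card L
  have hl : 0 < l := Nat.card_pos
  -- More than 2sl elements in T make l / |T| less than 1 / (2s).
  obtain ⟨P, hP⟩ := Infinite.exists_subset_card_eq K (2 * s * l + 1)
  let M := Subgroup.closure (P : Set K)
  have : Finite M := hK _ ⟨P, rfl⟩
  let T : Finset K := (Set.toFinite (M : Set K)).toFinset
  have hT : ∀ g, g ∈ T ↔ g ∈ M := fun g => Set.Finite.mem_toFinset _
  have hPT : 2 * s * l + 1 ≤ T.card :=
    hP ▸ Finset.card_le_card fun g hg => (hT g).2 (Subgroup.subset_closure hg)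
  obtain ⟨C, n, S', h⟩ := hS ⟨T, fun g hg => (hT _).2 (inv_mem ((hT g).1 hg)),
    (hT 1).2 (one_mem M)⟩
  obtain ⟨α, hα⟩ := h𝒴
  obtain ⟨W, V, mW, mV, hsum, hSW, hconn⟩ := h α hα
  let J : Finset (Fin n) := Finset.univ.filter fun j => s + 1 ≤ ι (S' j).1
  let Q : Fin n → Finset K := fun j =>
    (Set.toFinite (H (ι (S' j).1) : Set K)).toFinset
  have hQ : ∀ j g, g ∈ Q j ↔ g ∈ H (ι (S' j).1) := fun j g => Set.Finite.mem_toFinset _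
  have hQc : ∀ j, (Q j).card = Nat.card (H (ι (S' j).1)) := fun j =>
    (Nat.card_eq_card_finite_toFinset _).symm
  have mpre : ∀ (g : K) (j : Fin n), MeasurableSet ((fun z : α.carrier => g • z) ⁻¹' V j) :=
    fun g j => (α.measurePreserving_smul g).measurable (mV j)
  let B : Set α.carrier := ⋃ j ∈ J, ⋃ g ∈ Q j, (fun z => g • z) ⁻¹' V j
  have mB : MeasurableSet B :=
    J.measurableSet_biUnion fun j _ => (Q j).measurableSet_biUnion fun g _ => mpre g j
  have hB : 2 ^ (s + 1) * α.μ B ≤ 1 := by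
    refine le_trans ?_ hsum
    calc (2 : ℝ≥0∞) ^ (s + 1) * α.μ B
        ≤ 2 ^ (s + 1) * ∑ j ∈ J, (Q j).card * α.μ (V j) := by
          gcongr
          refine (measure_biUnion_finset_le _ _).trans (Finset.sum_le_sum fun j _ => ?_)
          refine (measure_biUnion_finset_le _ _).trans (le_of_eq ?_)
          rw [Finset.sum_congr rfl fun g _ =>
            (α.measurePreserving_smul g).measure_preimage (mV j).nullMeasurableSet]
          simp
      _ = ∑ j ∈ J, 2 ^ (s + 1) * (Q j).card * α.μ (V j) := by
          rw [Finset.mul_sum]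
          exact Finset.sum_congr rfl fun j _ => (mul_assoc _ _ _).symm
      _ ≤ ∑ j ∈ J, ((2 ^ ι (S' j).1 * (Nat.card (H (ι (S' j).1)) : ℝ≥0) : ℝ≥0) : ℝ≥0∞)
            * α.μ (V j) := by
          refine Finset.sum_le_sum fun j hj => ?_
          push_cast
          rw [hQc]
          gcongr
          · exact one_le_two
          · exact (Finset.mem_filter.1 hj).2
      _ ≤ _ := Finset.sum_le_sum_of_subset (Finset.subset_univ J)
  -- Since T is a subgroup, two points of W in one T-orbit are joined by a path; starting off B, it
  -- stays in one L-orbit. So each T-orbit has at most l points in W \ B.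
  have hcount : (T.card : ℝ≥0∞) * α.μ (W \ B) ≤ l := by
    refine α.card_mul_measure_le (mW.diff mB) T l (α.free.mono fun z hz A hA hAz => ?_)
    rcases A.eq_empty_or_nonempty with rfl | ⟨g₀, hg₀⟩
    · exact Nat.zero_le _
    obtain ⟨hg₀W, hg₀B⟩ := hAz g₀ hg₀
    have hg₀T := hA hg₀
    have hsub : A ⊆ (Set.toFinite (L : Set K)).toFinset.image (· * g₀) := by
      intro g hg
      have hgW := (hAz g hg).1
      have hgT := hA hg
      have hpath := hconn (g₀ • z) hg₀W (g • z) hgW (g * g₀⁻¹)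
        ((hT _).2 (mul_mem ((hT g).1 hgT) (inv_mem ((hT g₀).1 hg₀T))))
        (by rw [mul_smul, inv_smul_smul])
      obtain ⟨k, hk, e⟩ := hpath.exists_smul_eq L fun j => by
        by_cases hj : s + 1 ≤ ι (S' j).1
        · refine .inr fun k hk hV => hg₀B ?_
          refine Set.mem_biUnion (Finset.mem_filter.2 ⟨Finset.mem_univ j, hj⟩) ?_
          exact Set.mem_biUnion ((hQ j k).2 (Hmono hj hk)) hV
        · exact .inl ((hι _).trans (Hmono (by omega)))
      refine Finset.mem_image.2 ⟨k, (Set.Finite.mem_toFinset _).2 hk, ?_⟩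
      -- Freeness at z turns g • z = k • g₀ • z into g = k * g₀.
      by_contra hne
      refine hz (g⁻¹ * (k * g₀)) (fun h1 => hne (inv_mul_eq_one.1 h1).symm) ?_
      rw [mul_smul, mul_smul, ← e, inv_smul_smul]
    exact (Finset.card_le_card hsub).trans
      (Finset.card_image_le.trans (Nat.card_eq_card_finite_toFinset (Set.toFinite (L : Set K))).ge)
  have hone := α.one_le_card_mul_measure S mW hSW
  have hWle : α.μ W ≤ α.μ (W \ B) + α.μ B :=
    (measure_mono fun z hz => by
      by_cases hzB : z ∈ B
      exacts [.inr hzB, .inl ⟨hz, hzB⟩]).trans (measure_union_le _ _)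
  have hne : ∀ E : Set α.carrier, α.μ E ≠ ∞ := fun E => measure_ne_top _ _
  have hone' : (1 : ℝ) ≤ s * (α.μ.real (W \ B) + α.μ.real B) := by
    have h1 := ENNReal.toReal_mono
      (ENNReal.mul_ne_top (ENNReal.natCast_ne_top _) (ENNReal.add_ne_top.2 ⟨hne _, hne _⟩)) (hone.trans (mul_le_mul_right hWle _))
    rwa [ENNReal.toReal_mul, ENNReal.toReal_add (hne _) (hne _)] at h1
  have hB' : (2 : ℝ) ^ (s + 1) * α.μ.real B ≤ 1 := by
    simpa [Measure.real] using ENNReal.toReal_mono ENNReal.one_ne_top hB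
  have hcount' : (T.card : ℝ) * α.μ.real (W \ B) ≤ l := by
    simpa [Measure.real] using ENNReal.toReal_mono (ENNReal.natCast_ne_top _) hcount
  have hs : (s : ℝ) < 2 ^ s := by exact_mod_cast Nat.lt_two_pow_self
  have hPT' : (2 * s * l + 1 : ℝ) ≤ T.card := by exact_mod_cast hPT
  have hl' : (0 : ℝ) < l := by exact_mod_cast hl
  -- Both W \ B and B contribute at most 1/2 to s μ(W); s < 2^s makes the second bound strict,
  -- contradicting s μ(W) ≥ 1.
  have b1 : 2 * (s * α.μ.real B) ≤ 1 := by
    rw [pow_succ] at hB'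
    nlinarith [measureReal_nonneg (μ := α.μ) (s := B)]
  have b2 : 2 * (s * α.μ.real (W \ B)) ≤ 1 := by
    refine le_of_mul_le_mul_left ?_ hl'
    nlinarith [measureReal_nonneg (μ := α.μ) (s := W \ B)]
  have b3 : 2 * (s * α.μ.real B) < 1 := by
    rcases (measureReal_nonneg (μ := α.μ) (s := B)).eq_or_lt with h0 | h0
    · rw [← h0]; norm_num
    · rw [pow_succ] at hB'
      nlinarith
  linarith

/-- A finitely generated subgroup embeds in the product of its two projections, which are finitely
generated and hence finite. -/
theorem IsLocallyFiniteGroup.prod {G : Type u} {Γ : Type v} [Group G] [Group Γ]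
    (hG : IsLocallyFiniteGroup G) (hΓ : IsLocallyFiniteGroup Γ) :
    IsLocallyFiniteGroup (G × Γ) := by
  classical
  rintro H ⟨A, rfl⟩
  set H := Subgroup.closure (A : Set (G × Γ))
  have h1 := hG (H.map (MonoidHom.fst G Γ))
    ⟨A.image (MonoidHom.fst G Γ), by rw [Finset.coe_image, MonoidHom.map_closure]⟩
  have h2 := hΓ (H.map (MonoidHom.snd G Γ))
    ⟨A.image (MonoidHom.snd G Γ), by rw [Finset.coe_image, MonoidHom.map_closure]⟩
  refine Finite.of_injective (β := H.map (MonoidHom.fst G Γ) × H.map (MonoidHom.snd G Γ))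
    (fun h => (⟨h.1.1, h.1, h.2, rfl⟩, ⟨h.1.2, h.1, h.2, rfl⟩)) fun a b hab => ?_
  simp only [Prod.mk.injEq] at hab
  exact Subtype.ext (Prod.ext (congrArg Subtype.val hab.1) (congrArg Subtype.val hab.2))

end LocallyFinite

/-! ### Free p.m.p. actions from injective Gaussian sequences. -/

section Bernoulli

/-- The injective real sequences. -/
abbrev InjectiveSeq : Type w := {x : ULift.{w} ℕ → ℝ // Function.Injective x}

theorem measurableSet_injective_seq :
    MeasurableSet {x : ULift.{w} ℕ → ℝ | Function.Injective x} := by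
  have : {x : ULift.{w} ℕ → ℝ | Function.Injective x} =
      ⋂ (i) (j) (_ : i ≠ j), {x | x i = x j}ᶜ := by
    ext x
    simp only [Set.mem_ofPred_eq, Set.mem_iInter, Set.mem_compl_iff]
    exact ⟨fun h i j hij e => hij (h e), fun h i j e => by_contra fun hij => h i j hij e⟩
  rw [this]
  exact .iInter fun i => .iInter fun j => .iInter fun _ =>
    (measurableSet_eq_fun (measurable_pi_apply i) (measurable_pi_apply j)).compl

instance : StandardBorelSpace InjectiveSeq.{w} := measurableSet_injective_seq.standardBorel

/-- The law of a sequence of independent standard Gaussian variables. -/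
noncomputable def gaussianSeq : Measure (ULift.{w} ℕ → ℝ) :=
  Measure.infinitePi fun _ => ProbabilityTheory.gaussianReal 0 1

instance : IsProbabilityMeasure gaussianSeq.{w} := by
  unfold gaussianSeq; infer_instance

/-- Two independent atomless variables almost surely differ, and there are only countably many pairs
of indices. -/
theorem ae_gaussianSeq_injective : ∀ᵐ x ∂gaussianSeq.{w}, Function.Injective x := by
  have : ∀ i j : ULift.{w} ℕ, i ≠ j → ∀ᵐ x ∂gaussianSeq.{w}, x i ≠ x j := by
    intro i j hij
    have := ProbabilityTheory.nullSingletonClass_gaussianReal (μ := 0) (v := 1) one_ne_zero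
    have h := Measure.infinitePi_map_eval_prod
      (P := fun _ : ULift.{w} ℕ => ProbabilityTheory.gaussianReal 0 1) hij
    have h2 : ∀ᵐ p ∂(ProbabilityTheory.gaussianReal 0 1).prod
        (ProbabilityTheory.gaussianReal 0 1), p.1 ≠ p.2 := by
      have hm : MeasurableSet {p : ℝ × ℝ | p.1 ≠ p.2} :=
        (measurableSet_eq_fun measurable_fst measurable_snd).compl
      rw [Measure.ae_prod_iff_ae_ae hm]
      refine Filter.Eventually.of_forall fun x => ?_
      rw [ae_iff]
      simp only [ne_eq, not_not]
      have e : {y : ℝ | x = y} = {x} := by ext y; simp [eq_comm]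
      rw [e]
      exact measure_singleton x
    rw [← h] at h2
    exact ae_of_ae_map (f := fun x : ULift.{w} ℕ → ℝ => (x i, x j)) (by fun_prop) h2
  have h : ∀ᵐ x ∂gaussianSeq.{w}, ∀ i j : ULift.{w} ℕ, i ≠ j → x i ≠ x j := by
    simp only [ae_all_iff]
    exact this
  filter_upwards [h] with x hx i j e
  exact by_contra fun hij => hx i j hij e

/-- The law of `gaussianSeq` on the injective sequences. -/
noncomputable def gaussianInjectiveSeq : Measure InjectiveSeq.{w} :=
  gaussianSeq.{w}.comap Subtype.val

theorem map_val_gaussianInjectiveSeq :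
    gaussianInjectiveSeq.{w}.map Subtype.val = gaussianSeq.{w} := by
  have hemb : MeasurableEmbedding (Subtype.val : InjectiveSeq.{w} → _) :=
    .subtype_coe measurableSet_injective_seq
  rw [gaussianInjectiveSeq, hemb.map_comap, Subtype.range_coe_subtype]
  exact Measure.restrict_eq_self_of_ae_mem ae_gaussianSeq_injective

instance : IsProbabilityMeasure gaussianInjectiveSeq.{w} := by
  have h : IsProbabilityMeasure (gaussianInjectiveSeq.{w}.map Subtype.val) := by
    rw [map_val_gaussianInjectiveSeq]; infer_instance
  constructor
  have := h.measure_univ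
  rwa [Measure.map_apply measurable_subtype_coe .univ] at this

/-- A countably infinite group has a free Borel action on a standard Borel space with an invariant
probability measure. -/
theorem exists_free_pmp_action (G : Type u) [Group G] [Countable G] [Infinite G] :
    ∃ (X : Type w) (_ : MeasurableSpace X) (_ : StandardBorelSpace X) (_ : MulAction G X)
      (_ : MeasurableConstSMul G X) (_ : IsCancelSMul G X) (μ : Measure X)
      (_ : IsProbabilityMeasure μ), ∀ g : G, MeasurePreserving (fun x : X => g • x) μ μ := by
  obtain ⟨e⟩ : Nonempty (G ≃ ULift.{w} ℕ) := by
    obtain ⟨_⟩ := nonempty_denumerable G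
    exact ⟨(Denumerable.eqv G).trans Equiv.ulift.symm⟩
  let σ : G → ULift.{w} ℕ → ULift.{w} ℕ := fun g i => e (g⁻¹ * e.symm i)
  have σinj : ∀ g, Function.Injective (σ g) := fun g i j h => by simpa [σ] using h
  let act : MulAction G InjectiveSeq.{w} :=
    { smul := fun g x => ⟨fun i => x.1 (σ g i), x.2.comp (σinj g)⟩
      one_smul := fun x => Subtype.ext (funext fun i => congrArg x.1 (by simp [σ]))
      mul_smul := fun g h x => Subtype.ext (funext fun i => congrArg x.1 (by simp [σ, mul_assoc])) }
  have hsmul : ∀ (g : G) (x : InjectiveSeq.{w}), (g • x).1 = fun i => x.1 (σ g i) :=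
    fun _ _ => rfl
  have hmeas : ∀ g : G, Measurable fun x : InjectiveSeq.{w} => g • x := fun g =>
    Measurable.subtype_mk (f := fun (x : InjectiveSeq.{w}) i => x.1 (σ g i))
      (measurable_pi_lambda _ fun i => (measurable_pi_apply (σ g i)).comp measurable_subtype_coe)
  refine ⟨InjectiveSeq.{w}, inferInstance, inferInstance, act, ⟨hmeas⟩, ?_,
    gaussianInjectiveSeq, inferInstance, fun g => ⟨hmeas g, ?_⟩⟩
  · refine { left_cancel' := fun g x y h => smul_left_cancel g h, right_cancel' := ?_ }
    intro g h x hx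
    -- Every point is an injective sequence, so a single coordinate determines the group element.
    have h1 := congrFun (congrArg Subtype.val hx) (e 1)
    rw [hsmul, hsmul] at h1
    simpa [σ] using x.2 h1
  · have hemb : MeasurableEmbedding (Subtype.val : InjectiveSeq.{w} → _) :=
      .subtype_coe measurableSet_injective_seq
    have key : (gaussianInjectiveSeq.{w}.map fun x => g • x).map Subtype.val =
        gaussianInjectiveSeq.{w}.map Subtype.val := by
      rw [Measure.map_map measurable_subtype_coe (hmeas g)]
      have : Subtype.val ∘ (fun x : InjectiveSeq.{w} => g • x) =
          (fun (y : ULift.{w} ℕ → ℝ) i => y (σ g i)) ∘ Subtype.val := rfl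
      rw [this, ← Measure.map_map (by fun_prop) measurable_subtype_coe,
        map_val_gaussianInjectiveSeq]
      exact Measure.map_infinitePi_infinitePi_of_inj (σinj g)
    -- A measure on the subtype is recovered from its pushforward along the embedding, where
    -- invariance is that of an i.i.d. law under reindexing.
    rw [← hemb.comap_map (gaussianInjectiveSeq.{w}.map fun x => g • x), key, hemb.comap_map]

theorem productActions_nonempty (G : Type u) (Γ : Type v) [Group G] [Group Γ] [Countable G]
    [Countable Γ] [Infinite G] [Infinite Γ] : (productActions.{u, v, w} G Γ).Nonempty := by
  obtain ⟨X, h₁, h₂, h₃, h₄, h₅, μ, _, hμ⟩ := exists_free_pmp_action.{u, w} G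
  obtain ⟨Y, k₁, k₂, k₃, k₄, k₅, ν, _, hν⟩ := exists_free_pmp_action.{v, w} Γ
  exact ⟨FreePMPAction.prod G Γ X Y (μ.prod ν) fun g γ => (hμ g).prod (hν γ),
    X, Y, h₁, h₂, h₃, h₄, h₅, k₁, k₂, k₃, k₄, k₅, μ.prod ν, inferInstance, _, rfl⟩

end Bernoulli

theorem mainTheorem9 (G : Type u) (Γ : Type v) [Group G] [Group Γ] [Countable G] [Countable Γ]
    [Infinite G] [Infinite Γ] :
    PropertySCForProductActions.{u, v, w} G Γ ↔
      (¬ IsLocallyFiniteGroup G ∨ ¬ IsLocallyFiniteGroup Γ) := by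
  refine ⟨fun h => ?_, fun h => ?_⟩
  · by_contra hlf
    push Not at hlf
    exact not_propertySC_of_isLocallyFiniteGroup (hlf.1.prod hlf.2) _
      (productActions_nonempty G Γ) h
  · rcases h with h | h
    · exact propertySC_of_not_isLocallyFiniteGroup_left h
    · exact propertySC_of_not_isLocallyFiniteGroup_right h
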